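/- Let $a,b,c,d\in\mathbb{R}^3$ be the vertices of a regular tetrahedron with sides of length $2$, and let $T$ be its Reuleaux tetrahedron, the intersection of the four closed balls of radius $2$ centered at the vertices. **Robert's body.** A *parabolic pea pod device* $\Sigma$ with beam $ab$ consists of a principal circle of center $o\notin ab$ and radius $r$ that has $ab$ as a chord, in the plane $H_\Sigma$ through $a,b,o$. Its *axis* is the line through $o$ and the midpoint of $ab$. $E(\Sigma)$ is the closed arc from $a$ to $b$ formed by the centers $x\in H_\Sigma$, lying in the closed half plane bounded by the line $ab$ opposite to $o$, of the (possibly degenerate) disks tangent to the line $ab$ and internally tangent to the principal circle; $R(x)$ denotes the radius of the disk centered at $x$. This arc lies on a parabola in $H_\Sigma$ with focus $o$, the *pea string*. Two such devices $\Sigma_1,\Sigma_2$, with beams $ab$ and $cd$ and principal centers $o_1,o_2$, are *convex confocal* if they have the same axis, their planes are orthogonal, the focus of each pea string lies on the other pea string, $o_1$ is the point of $E(\Sigma_2)$ on the axis, and $o_2$ is the point of $E(\Sigma_1)$ on the axis. For the regular tetrahedron there is exactly one such pair. The *wedge-pod surface* $(AB)$ is the set of all points $$\phi(x,y)=x+R(x)\,\frac{x-y}{|x-y|},\qquad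 x\in E(\Sigma_1),\ y\in E(\Sigma_2),$$ and its boundary curve on the sphere $\mathbb{S}(c,2)$ is $\tilde C_{AB}=\{\phi(x,c): x\in E(\Sigma_1)\}$. The wedge-pod surfaces along the other five edges, and their boundary curves, are defined in the same way. For each vertex, say $c$, the *spherical cap* $(C)$ is the part of $\mathbb{S}(c,2)$ that is bounded by the closed curve $\tilde C_{AB}\cup\tilde C_{BD}\cup\tilde C_{DA}$ and contained in the boundary of $T$. *Robert's body* $\mathcal{R}$ is the convex hull of the union of the four spherical caps and the six wedge-pod surfaces. **Meissner bodies.** Given a regular tetrahedron of side $1$ and its Reuleaux tetrahedron of width $1$, *rounding* the edge with end points $a',b'$ (the other two vertices being $c',d'$) means replacing the part of the Reuleaux tetrahedron in the dihedral wedge bounded by the half planes of $a'b'c'$ and $a'b'd'$ that lie beyond the line $a'b'$ by the part in that wedge of the solid of revolution generated by rotating about $a'b'$ the circular segment between $a'b'$ and the minor arc of radius $1$ from $a'$ to $b'$. The two Meissner bodies of constant width $1$ are obtained by rounding the three edges at one vertex, respectively the three edges of one face. **Theorem.** Let $M_1$ and $M_2$ be the two Meissner bodies of constant width $1$ over the regular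 tetrahedron $\frac a2,\frac b2,\frac c2,\frac d2$: $M_1$ with the three edges at some vertex rounded, and $M_2$ with the three edges of some face rounded (any vertex and any face). Then the Minkowski sum $M_1+M_2$ is not Robert's body: $$M_1+M_2\neq\mathcal{R}.$$ Moreover, the two bodies have different sections: if $H$ is the plane that contains an edge of the tetrahedron $abcd$ and passes through the midpoint of the opposite edge, then $H\cap(M_1+M_2)\neq H\cap\mathcal{R}$. -/

import Mathlib

open scoped Pointwise

noncomputable section

namespace Peabody

/-- Euclidean 3-space. -/
abbrev E3 := EuclideanSpace ℝ (Fin 3)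

/-- `p` lists the vertices of a regular tetrahedron with sides of length `s`. -/
def IsRegularTetrahedron (p : Fin 4 → E3) (s : ℝ) : Prop :=
  ∀ i j, i ≠ j → dist (p i) (p j) = s

/-- The intersection of the four balls of radius `s` centered at the vertices `p i`: the Reuleaux
tetrahedron, when `p` is a regular tetrahedron of side `s`. -/
def reuleauxTetrahedron (p : Fin 4 → E3) (s : ℝ) : Set E3 :=
  ⋂ i, Metric.closedBall (p i) s

/-! ### Parabolic pea pod devices -/

/-- A parabolic pea pod frame whose longitudinal beam is the segment `ab`: the principal circle
(with the given center and radius, in the plane of `a`, `b` and the center) has `ab` as a chord,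
and the second circle of the frame is the line through `a` and `b`. -/
structure ParabolicPod (a b : E3) where
  center : E3
  radius : ℝ
  dist_left : dist center a = radius
  dist_right : dist center b = radius
  center_notMem : center ∉ line[ℝ, a, b]

namespace ParabolicPod

variable {a b : E3}

/-- The plane of the frame. -/
def plane (S : ParabolicPod a b) : AffineSubspace ℝ E3 :=
  affineSpan ℝ {a, b, S.center}

/-- The axis of the frame: the line through the center of the principal circle and the midpoint of
the beam (it is perpendicular to the beam). -/
def axis (S : ParabolicPod a b) : AffineSubspace ℝ E3 :=
  line[ℝ, S.center, midpoint ℝ a b]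

/-- The radius of the ball of the pea pod centered at `x`: the disk around `x` is tangent to the
line through the beam. -/
def peaRadius (_S : ParabolicPod a b) (x : E3) : ℝ :=
  Metric.infDist x (line[ℝ, a, b] : Set E3)

/-- The set `E(Σ)` of the centers of the disks of the pea pod. These disks lie in the plane of the
frame, their centers lie in the half plane of the beam opposite to the principal center, and they
are tangent to the beam and, from inside, to the principal circle. The degenerate disks `{a}` and
`{b}` are included, so that this is a closed arc from `a` to `b`. -/
def arc (S : ParabolicPod a b) : Set E3 :=
  {x | x ∈ S.plane ∧ line[ℝ, a, b].WOppSide S.center x ∧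
    dist x S.center + S.peaRadius x = S.radius}

/-- The line parallel to the beam, at distance `radius` from it, on the side opposite to the
principal center. -/
def directrix (S : ParabolicPod a b) : AffineSubspace ℝ E3 :=
  AffineSubspace.mk'
    (midpoint ℝ a b +
      (S.radius / dist (midpoint ℝ a b) S.center) • (midpoint ℝ a b - S.center))
    (Submodule.span ℝ {b - a})

/-- The parabolic pea string: the parabola in the plane of the frame that contains the centers of
the disks. Its focus is the center of the principal circle. -/
def peaString (S : ParabolicPod a b) : Set E3 :=
  {x | x ∈ S.plane ∧ dist x S.center = Metric.infDist x (S.directrix : Set E3)}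

/-- `x` is the center of the bulb, the ball of the pea pod whose center lies on the axis. -/
def IsBulbCenter (S : ParabolicPod a b) (x : E3) : Prop :=
  x ∈ S.arc ∧ x ∈ S.axis

end ParabolicPod

/-- Confocal parabolic pea pod devices: they have the same axis, their planes are orthogonal, and
their pea strings are confocal, that is, the focus of each of the two parabolas lies on the
other. -/
def Confocal {a b c d : E3} (S : ParabolicPod a b) (S' : ParabolicPod c d) : Prop :=
  S.axis = S'.axis ∧
  S.plane.directionᗮ ≤ S'.plane.direction ∧
  S.center ∈ S'.peaString ∧ S'.center ∈ S.peaString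

/-- Convex confocal devices: moreover, the center of the principal circle of each device is the
center of the bulb of the other one. -/
def ConvexConfocal {a b c d : E3} (S : ParabolicPod a b) (S' : ParabolicPod c d) : Prop :=
  Confocal S S' ∧ S'.IsBulbCenter S.center ∧ S.IsBulbCenter S'.center

/-- The point of the line through `x` and `y` at distance `ρ` from `x` such that `x` lies between
it and `y`. -/
def outerPoint (ρ : ℝ) (x y : E3) : E3 :=
  x + (ρ / dist x y) • (x - y)

/-! ### Robert's body -/

/-- The wedge-pod surface along `ab` of the convex confocal pair of parabolic pea pod devices with
longitudinal beams `ab` and `cd` (when `a, b, c, d` is a regular tetrahedron, there is exactly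
one such pair). The wedge-pod surface along `cd` is `wedgePod c d a b`. -/
def wedgePod (a b c d : E3) : Set E3 :=
  {q | ∃ (S : ParabolicPod a b) (S' : ParabolicPod c d), ConvexConfocal S S' ∧
    ∃ x ∈ S.arc, ∃ y ∈ S'.arc, q = outerPoint (S.peaRadius x) x y}

/-- The boundary curve of `wedgePod a b c d` that lies on the sphere centered at `c`: the points of
this surface obtained for `y = c`. It joins `a` and `b`. -/
def wedgeCurve (a b c d : E3) : Set E3 :=
  {q | ∃ (S : ParabolicPod a b) (S' : ParabolicPod c d), ConvexConfocal S S' ∧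
    ∃ x ∈ S.arc, q = outerPoint (S.peaRadius x) x c}

/-- The closed curve on the sphere centered at the vertex `p i` that is made of the three boundary
curves of the wedge-pod surfaces along the edges of the face opposite to `p i`. -/
def capCurve (p : Fin 4 → E3) (i : Fin 4) : Set E3 :=
  ⋃ (σ : Equiv.Perm (Fin 4)) (_ : σ 2 = i),
    wedgeCurve (p (σ 0)) (p (σ 1)) (p (σ 2)) (p (σ 3))

/-- The closed spherical cap of the sphere of radius `s` around `p i` that is bounded by
`capCurve p i` and contained in the boundary of the Reuleaux tetrahedron: the curve, together with
the component of its complement in the sphere that is contained in that boundary. -/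
def sphericalCap (p : Fin 4 → E3) (s : ℝ) (i : Fin 4) : Set E3 :=
  {q | q ∈ Metric.sphere (p i) s ∧
    (q ∈ capCurve p i ∨
      connectedComponentIn (Metric.sphere (p i) s \ capCurve p i) q ⊆
        frontier (reuleauxTetrahedron p s))}

/-- The surface assembled from the four spherical caps and the six wedge-pod surfaces. -/
def robertsSurface (p : Fin 4 → E3) (s : ℝ) : Set E3 :=
  (⋃ i, sphericalCap p s i) ∪
    ⋃ σ : Equiv.Perm (Fin 4), wedgePod (p (σ 0)) (p (σ 1)) (p (σ 2)) (p (σ 3))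

/-- Robert's body over the regular tetrahedron `p` with sides of length `2`. -/
def robertsBody (p : Fin 4 → E3) : Set E3 :=
  convexHull ℝ (robertsSurface p 2)

/-! ### The Meissner bodies -/

/-- The dihedral wedge with edge the line `ab`, bounded by the half planes of the faces `abc` and
`abd` that lie beyond `ab`, opposite to `c` and to `d`. -/
def dihedralWedge (a b c d : E3) : Set E3 :=
  {x | ∃ t s s' : ℝ, 0 ≤ s ∧ 0 ≤ s' ∧ x = a + t • (b - a) + s • (a - c) + s' • (a - d)}

/-- The circular segment in the plane `abc`, beyond `ab` as seen from `c`, bounded by the segment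
`ab` and the arc from `a` to `b` of the circle of radius `s` centered at `c`. -/
def circularSegment (a b c : E3) (s : ℝ) : Set E3 :=
  {x | (∃ t u : ℝ, 0 ≤ u ∧ x = a + t • (b - a) + u • (a - c)) ∧ dist x c ≤ s}

/-- The solid of revolution generated by rotating `circularSegment a b c s` about the line `ab`.
Two points lie on the same circle about that line iff they have the same distances to `a` and
to `b`. -/
def spindle (a b c : E3) (s : ℝ) : Set E3 :=
  {x | ∃ y ∈ circularSegment a b c s, dist x a = dist y a ∧ dist x b = dist y b}

/-- The body obtained from the Reuleaux tetrahedron of width `s` over `p` by rounding the edges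
`ij` with `rounded i j`: the part of it in the dihedral wedge along such an edge is replaced by
the part of the solid of revolution in that wedge. -/
def roundedReuleaux (p : Fin 4 → E3) (s : ℝ) (rounded : Fin 4 → Fin 4 → Prop) : Set E3 :=
  {x | x ∈ reuleauxTetrahedron p s ∧ ∀ σ : Equiv.Perm (Fin 4), rounded (σ 0) (σ 1) →
    x ∈ dihedralWedge (p (σ 0)) (p (σ 1)) (p (σ 2)) (p (σ 3)) →
    x ∈ spindle (p (σ 0)) (p (σ 1)) (p (σ 2)) s}

/-- The Meissner body in which the three edges at the vertex `p v` are rounded. -/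
def meissnerVertex (p : Fin 4 → E3) (s : ℝ) (v : Fin 4) : Set E3 :=
  roundedReuleaux p s fun i j => i = v ∨ j = v

/-- The Meissner body in which the three edges of the face opposite to the vertex `p w` are
rounded. -/
def meissnerFace (p : Fin 4 → E3) (s : ℝ) (w : Fin 4) : Set E3 :=
  roundedReuleaux p s fun i j => i ≠ w ∧ j ≠ w

end Peabody

end

namespace Peabody

open scoped RealInnerProductSpace

/-! The sections are separated by a point of Robert's body beyond a supporting line of the sum. Take
coordinates with `ab` along the first axis, `cd` parallel to the second, and the third axis through
both midpoints; the section is Y = 0. Let (S, 0, C) be a unit normal with S ≥ 0 and √3 S ≤ C, and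
set β = (2 - √2)/4.

By `framePoint_mem_wedgePod`, the pea at the bulb of `cd` gives Robert's body an arc of radius β
about (0, 0, √2 + β), reaching (√2 + β) C + β in direction (S, 0, C). Only membership matters, so
one explicit confocal pair suffices, without its uniqueness.

After doubling, a Meissner body reaches at most √3 C if `cd` is sharp (`support_le_of_balls`), and
at most √2 C + (2 - √3) if it is rounded (`support_le_of_mem_spindle`,
`support_le_of_notMem_dihedralWedge`). The sum obeys the average of the two bounds for its summands.

If `cd` is rounded in at least one summand, the excess of Robert's body over the average of one
sharp and one rounded bound is (1 - C)(β - (2 - √3)/2). It vanishes on the axis and is positive for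
C < 1, so a tilted direction works. If `cd` is rounded in neither summand, then `ab` is rounded in
both, and the axis direction at `ab` already separates, because 2 - √3 + √2 < √2 + 2β. -/

/-! ### Coordinates in an orthonormal frame -/

/-- The point with coordinates `X, Y, Z` in the frame `e` with origin `o`. -/
noncomputable def framePoint (o : E3) (e : Fin 3 → E3) (X Y Z : ℝ) : E3 :=
  o + X • e 0 + Y • e 1 + Z • e 2

theorem dist_framePoint_sq {e : Fin 3 → E3} (he : Orthonormal ℝ e) (o : E3)
    (X Y Z X' Y' Z' : ℝ) :
    dist (framePoint o e X Y Z) (framePoint o e X' Y' Z') ^ 2 =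
      (X - X') ^ 2 + (Y - Y') ^ 2 + (Z - Z') ^ 2 := by
  have h : framePoint o e X Y Z - framePoint o e X' Y' Z' =
      (X - X') • e 0 + (Y - Y') • e 1 + (Z - Z') • e 2 := by
    simp only [framePoint]; module
  have h' := orthonormal_iff_ite.1 he
  rw [dist_eq_norm, h, ← real_inner_self_eq_norm_sq]
  simp only [inner_add_left, inner_add_right, real_inner_smul_left, real_inner_smul_right, h']
  simp
  ring

theorem dist_framePoint_le_iff {e : Fin 3 → E3} (he : Orthonormal ℝ e) (o : E3)
    (X Y Z X' Y' Z' : ℝ) {r : ℝ} (hr : 0 ≤ r) :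
    dist (framePoint o e X Y Z) (framePoint o e X' Y' Z') ≤ r ↔
      (X - X') ^ 2 + (Y - Y') ^ 2 + (Z - Z') ^ 2 ≤ r ^ 2 := by
  rw [← dist_framePoint_sq he o, sq_le_sq₀ dist_nonneg hr]

theorem le_dist_framePoint_iff {e : Fin 3 → E3} (he : Orthonormal ℝ e) (o : E3)
    (X Y Z X' Y' Z' : ℝ) {r : ℝ} (hr : 0 ≤ r) :
    r ≤ dist (framePoint o e X Y Z) (framePoint o e X' Y' Z') ↔
      r ^ 2 ≤ (X - X') ^ 2 + (Y - Y') ^ 2 + (Z - Z') ^ 2 := by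
  rw [← dist_framePoint_sq he o, sq_le_sq₀ hr dist_nonneg]

theorem dist_framePoint_eq {e : Fin 3 → E3} (he : Orthonormal ℝ e) (o : E3)
    (X Y Z X' Y' Z' : ℝ) {r : ℝ} (hr : 0 ≤ r)
    (h : (X - X') ^ 2 + (Y - Y') ^ 2 + (Z - Z') ^ 2 = r ^ 2) :
    dist (framePoint o e X Y Z) (framePoint o e X' Y' Z') = r := by
  rw [← dist_framePoint_sq he o] at h
  exact (sq_eq_sq₀ dist_nonneg hr).1 h

theorem framePoint_injective {e : Fin 3 → E3} (he : Orthonormal ℝ e) {o : E3}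
    {X Y Z X' Y' Z' : ℝ} (h : framePoint o e X Y Z = framePoint o e X' Y' Z') :
    X = X' ∧ Y = Y' ∧ Z = Z' := by
  have h1 := dist_framePoint_sq he o X Y Z X' Y' Z'
  rw [h, dist_self] at h1
  refine ⟨?_, ?_, ?_⟩ <;> nlinarith [sq_nonneg (X - X'), sq_nonneg (Y - Y'), sq_nonneg (Z - Z')]

theorem eq_sum_inner_smul_of_orthonormal {e : Fin 3 → E3} (he : Orthonormal ℝ e) (v : E3) :
    v = ⟪e 0, v⟫ • e 0 + ⟪e 1, v⟫ • e 1 + ⟪e 2, v⟫ • e 2 := by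
  have hc : Fintype.card (Fin 3) = Module.finrank ℝ E3 := by simp
  let B := (basisOfOrthonormalOfCardEqFinrank he hc).toOrthonormalBasis (by simpa using he)
  have hB : ∀ i, B i = e i := by intro i; simp [B]
  have := B.sum_repr' v
  simp only [Fin.sum_univ_three, hB] at this
  exact this.symm

theorem exists_eq_framePoint {e : Fin 3 → E3} (he : Orthonormal ℝ e) (o x : E3) :
    ∃ X Y Z, x = framePoint o e X Y Z := by
  refine ⟨⟪e 0, x - o⟫, ⟪e 1, x - o⟫, ⟪e 2, x - o⟫, ?_⟩
  have := eq_sum_inner_smul_of_orthonormal he (x - o)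
  rw [framePoint, add_assoc, add_assoc, ← add_assoc (_ • e 0), ← this]
  simp

/-! ### Frames adapted to a regular tetrahedron -/

/-- The frame `e` with origin `o` is adapted to the regular tetrahedron `abcd` of side `2`: the
origin is the midpoint of `ab`, and the third axis points to the midpoint of `cd`. -/
structure IsAdaptedFrame (o : E3) (e : Fin 3 → E3) (a b c d : E3) : Prop where
  orthonormal : Orthonormal ℝ e
  eq_a : a = framePoint o e 1 0 0
  eq_b : b = framePoint o e (-1) 0 0
  eq_c : c = framePoint o e 0 1 √2
  eq_d : d = framePoint o e 0 (-1) √2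

theorem exists_isAdaptedFrame {a b c d : E3} (hab : dist a b = 2) (hac : dist a c = 2)
    (had : dist a d = 2) (hbc : dist b c = 2) (hbd : dist b d = 2) (hcd : dist c d = 2) :
    ∃ o e, IsAdaptedFrame o e a b c d := by
  -- With `d` moved to the origin, the six distances become the Gram matrix of A, B, C: 4 on the
  -- diagonal, 2 elsewhere.
  obtain ⟨A, rfl⟩ : ∃ A, a = A + d := ⟨a - d, by simp⟩
  obtain ⟨B, rfl⟩ : ∃ B, b = B + d := ⟨b - d, by simp⟩
  obtain ⟨C, rfl⟩ : ∃ C, c = C + d := ⟨c - d, by simp⟩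
  simp only [dist_add_right, dist_add_self_left] at *
  have hs : √2 * √2 = 2 := Real.mul_self_sqrt (by norm_num)
  have hs0 : √2 ≠ 0 := by positivity
  have hAA : ⟪A, A⟫ = 4 := by rw [real_inner_self_eq_norm_sq, had]; norm_num
  have hBB : ⟪B, B⟫ = 4 := by rw [real_inner_self_eq_norm_sq, hbd]; norm_num
  have hCC : ⟪C, C⟫ = 4 := by rw [real_inner_self_eq_norm_sq, hcd]; norm_num
  have key : ∀ P Q : E3, ‖P‖ = 2 → ‖Q‖ = 2 → dist P Q = 2 → ⟪P, Q⟫ = 2 := by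
    intro P Q hP hQ hPQ
    have := norm_sub_sq_real P Q
    rw [← dist_eq_norm, hP, hQ, hPQ] at this
    linarith
  have hAB := key A B had hbd hab
  have hAC := key A C had hcd hac
  have hBC := key B C hbd hcd hbc
  have hBA : ⟪B, A⟫ = 2 := by rw [real_inner_comm]; exact hAB
  have hCA : ⟪C, A⟫ = 2 := by rw [real_inner_comm]; exact hAC
  have hCB : ⟪C, B⟫ = 2 := by rw [real_inner_comm]; exact hBC
  refine ⟨d + (1 / 2 : ℝ) • (A + B), ![(1 / 2 : ℝ) • (A - B), (1 / 2 : ℝ) • C,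
    (√2 / 4) • (C - A - B)], ?_, ?_, ?_, ?_, ?_⟩
  · rw [orthonormal_iff_ite]
    intro i j
    fin_cases i <;> fin_cases j <;>
    simp [inner_sub_left, inner_sub_right, real_inner_smul_left, real_inner_smul_right, hAA,
      hBB, hCC, hAB, hAC, hBC, hBA, hCA, hCB,
      -inner_self_eq_norm_sq_to_K] <;>
    linarith
  · simp [framePoint]; module
  · simp [framePoint]; module
  · simp only [framePoint, Matrix.cons_val_zero, Matrix.cons_val_one, Matrix.cons_val, smul_smul]
    rw [show √2 * (√2 / 4) = 1 / 2 by linarith]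
    module
  · simp only [framePoint, Matrix.cons_val_zero, Matrix.cons_val_one, Matrix.cons_val, smul_smul]
    rw [show √2 * (√2 / 4) = 1 / 2 by linarith]
    module

theorem framePoint_swap (o : E3) (e : Fin 3 → E3) (X Y Z : ℝ) :
    framePoint (framePoint o e 0 0 √2) ![e 1, e 0, -e 2] X Y Z = framePoint o e Y X (√2 - Z) := by
  simp [framePoint]; module

/-- The half-turn about the line through the midpoint of the axis segment in direction `e 0 + e 1`
exchanges the two opposite edges. Every fact about the `ab` pod therefore also serves for the `cd`
pod. -/
theorem IsAdaptedFrame.swap {o : E3} {e : Fin 3 → E3} {a b c d : E3}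
    (h : IsAdaptedFrame o e a b c d) :
    IsAdaptedFrame (framePoint o e 0 0 √2) ![e 1, e 0, -e 2] c d a b := by
  obtain ⟨he, ha, hb, hc, hd⟩ := h
  refine ⟨?_, ?_, ?_, ?_, ?_⟩
  · have h' := orthonormal_iff_ite.1 he
    rw [orthonormal_iff_ite]
    intro i j
    fin_cases i <;> fin_cases j <;> simp [h', -inner_self_eq_norm_sq_to_K]
  all_goals rw [framePoint_swap]; simp [*]

theorem lineMap_framePoint (o : E3) (e : Fin 3 → E3) (X Y Z X' Y' Z' t : ℝ) :
    AffineMap.lineMap (framePoint o e X Y Z) (framePoint o e X' Y' Z') t =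
      framePoint o e (X + t * (X' - X)) (Y + t * (Y' - Y)) (Z + t * (Z' - Z)) := by
  simp only [AffineMap.lineMap_apply, framePoint, vsub_eq_sub, vadd_eq_add]
  module

theorem infDist_eq_of_forall_le {s : Set E3} {x y : E3} {r : ℝ} (hy : y ∈ s) (hxy : dist x y = r)
    (h : ∀ z ∈ s, r ≤ dist x z) : Metric.infDist x s = r :=
  le_antisymm (hxy ▸ Metric.infDist_le_dist_of_mem hy)
    ((Metric.le_infDist ⟨y, hy⟩).2 fun z hz => h z hz)

theorem mem_axisLine_iff {o x : E3} {e : Fin 3 → E3} {s t : ℝ} (hst : s ≠ t) :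
    x ∈ line[ℝ, framePoint o e 0 0 s, framePoint o e 0 0 t] ↔ ∃ z, x = framePoint o e 0 0 z := by
  rw [mem_affineSpan_pair_iff_exists_lineMap_eq]
  constructor
  · rintro ⟨r, rfl⟩
    exact ⟨s + r * (t - s), by rw [lineMap_framePoint]; simp⟩
  · rintro ⟨z, rfl⟩
    refine ⟨(z - s) / (t - s), ?_⟩
    rw [lineMap_framePoint, div_mul_cancel₀ _ (sub_ne_zero.2 hst.symm)]
    simp

namespace IsAdaptedFrame

variable {o : E3} {e : Fin 3 → E3} {a b c d : E3}

theorem mem_beam_iff (h : IsAdaptedFrame o e a b c d)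
    {x : E3} : x ∈ line[ℝ, a, b] ↔ ∃ t, x = framePoint o e t 0 0 := by
  rw [mem_affineSpan_pair_iff_exists_lineMap_eq, h.eq_a, h.eq_b]
  constructor
  · rintro ⟨r, rfl⟩
    exact ⟨1 + r * (-1 - 1), by rw [lineMap_framePoint]; simp⟩
  · rintro ⟨t, rfl⟩
    refine ⟨(1 - t) / 2, ?_⟩
    rw [lineMap_framePoint]
    congr 1 <;> ring

theorem midpoint_beam (h : IsAdaptedFrame o e a b c d) : midpoint ℝ a b = framePoint o e 0 0 0 := by
  rw [midpoint, h.eq_a, h.eq_b, lineMap_framePoint]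
  congr 1 <;> norm_num

end IsAdaptedFrame

/-! ### The convex confocal pair and its bulb points -/

/-- The center of the principal circle, in an adapted frame, of the pod of the convex confocal
pair. -/
noncomputable def podCenter (o : E3) (e : Fin 3 → E3) : E3 :=
  framePoint o e 0 0 ((2 + 3 * √2) / 4)

theorem podCenter_swap (o : E3) (e : Fin 3 → E3) :
    podCenter (framePoint o e 0 0 √2) ![e 1, e 0, -e 2] =
      framePoint o e 0 0 (-((2 - √2) / 4)) := by
  rw [podCenter, framePoint_swap]
  congr 1
  ring

/-- The parabolic pod with beam `ab` of the convex confocal pair. -/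
noncomputable def confocalPod {o : E3} {e : Fin 3 → E3} {a b c d : E3}
    (h : IsAdaptedFrame o e a b c d) : ParabolicPod a b where
  -- Let β be the bulb radius. Symmetry under the half-turn puts the center at height √2 + β, and
  -- tangency of the bulb gives radius √2 + 3β. Since the circle passes through `a`, (√2 + 3β)² = 1
  -- + (√2 + β)², whence β = (2 - √2)/4.
  center := podCenter o e
  radius := (6 + √2) / 4
  dist_left := by
    rw [podCenter, h.eq_a]
    refine dist_framePoint_eq h.orthonormal _ _ _ _ _ _ _ (by positivity) ?_
    nlinarith [Real.sq_sqrt (show (0 : ℝ) ≤ 2 by norm_num)]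
  dist_right := by
    rw [podCenter, h.eq_b]
    refine dist_framePoint_eq h.orthonormal _ _ _ _ _ _ _ (by positivity) ?_
    nlinarith [Real.sq_sqrt (show (0 : ℝ) ≤ 2 by norm_num)]
  center_notMem := by
    rw [h.mem_beam_iff]
    rintro ⟨t, ht⟩
    have := (framePoint_injective h.orthonormal ht).2.2
    have h2 : 0 < √2 := by positivity
    linarith

namespace IsAdaptedFrame

variable {o : E3} {e : Fin 3 → E3} {a b c d : E3}

theorem framePoint_mem_plane (h : IsAdaptedFrame o e a b c d)
    (X Z : ℝ) : framePoint o e X 0 Z ∈ (confocalPod h).plane := by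
  have ha : line[ℝ, a, b] ≤ (confocalPod h).plane :=
    affineSpan_mono _ (by intro x hx; rcases hx with rfl | rfl <;> simp)
  have h0 := ha (h.mem_beam_iff.2 ⟨0, rfl⟩)
  have hX := ha (h.mem_beam_iff.2 ⟨X, rfl⟩)
  have hc : podCenter o e ∈ (confocalPod h).plane :=
    subset_affineSpan _ _ (by simp [confocalPod])
  have := AffineSubspace.smul_vsub_vadd_mem _ (Z / ((2 + 3 * √2) / 4)) hc h0 hX
  convert this using 1
  have h3 : Z / ((2 + 3 * √2) / 4) * ((2 + 3 * √2) / 4) = Z :=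
    div_mul_cancel₀ _ (by positivity)
  have h4 : podCenter o e - framePoint o e 0 0 0 = ((2 + 3 * √2) / 4) • e 2 := by
    simp only [podCenter, framePoint]; module
  rw [vsub_eq_sub, vadd_eq_add, h4, smul_smul, h3]
  simp only [framePoint]; module

theorem peaRadius_framePoint (h : IsAdaptedFrame o e a b c d) (X Z : ℝ) :
    (confocalPod h).peaRadius (framePoint o e X 0 Z) = |Z| := by
  refine infDist_eq_of_forall_le (h.mem_beam_iff.2 ⟨X, rfl⟩) ?_ ?_
  · exact dist_framePoint_eq h.orthonormal _ _ _ _ _ _ _ (abs_nonneg _) (by rw [sq_abs]; ring)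
  · intro z hz
    obtain ⟨t, rfl⟩ := h.mem_beam_iff.1 hz
    rw [le_dist_framePoint_iff h.orthonormal _ _ _ _ _ _ _ (abs_nonneg _), sq_abs]
    nlinarith [sq_nonneg (X - t)]

/-- Below the beam the pea radius is -Z, so internal tangency says that the distance to the
principal center is the radius plus Z; `hX` is the square of this. -/
theorem framePoint_mem_arc (h : IsAdaptedFrame o e a b c d)
    {X Z : ℝ} (hZ : Z ≤ 0) (hZ' : 0 ≤ (6 + √2) / 4 + Z)
    (hX : X ^ 2 + (Z - (2 + 3 * √2) / 4) ^ 2 = ((6 + √2) / 4 + Z) ^ 2) :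
    framePoint o e X 0 Z ∈ (confocalPod h).arc := by
  refine ⟨h.framePoint_mem_plane X Z, ?_, ?_⟩
  · refine ⟨framePoint o e 0 0 0, h.mem_beam_iff.2 ⟨0, rfl⟩, framePoint o e X 0 0,
      h.mem_beam_iff.2 ⟨X, rfl⟩, ?_⟩
    have h1 : (confocalPod h).center -ᵥ framePoint o e 0 0 0 = ((2 + 3 * √2) / 4) • e 2 := by
      simp only [confocalPod, podCenter, framePoint, vsub_eq_sub]; module
    have h2 : framePoint o e X 0 0 -ᵥ framePoint o e X 0 Z = (-Z) • e 2 := by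
      simp only [framePoint, vsub_eq_sub]; module
    rw [h1, h2]
    exact (SameRay.sameRay_nonneg_smul_left _ (by positivity)).trans
      (SameRay.sameRay_nonneg_smul_right _ (by linarith)) fun h0 => absurd h0 (h.orthonormal.ne_zero 2)
  · rw [h.peaRadius_framePoint, abs_of_nonpos hZ]
    have : dist (framePoint o e X 0 Z) (podCenter o e) = (6 + √2) / 4 + Z :=
      dist_framePoint_eq h.orthonormal _ _ _ _ _ _ _ hZ' (by linarith)
    change dist (framePoint o e X 0 Z) (podCenter o e) + -Z = (6 + √2) / 4
    linarith

theorem mem_axis_iff (h : IsAdaptedFrame o e a b c d)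
    {x : E3} : x ∈ (confocalPod h).axis ↔ ∃ z, x = framePoint o e 0 0 z := by
  have : (0 : ℝ) < (2 + 3 * √2) / 4 := by positivity
  rw [ParabolicPod.axis, h.midpoint_beam]
  exact mem_axisLine_iff this.ne'

theorem axis_eq_axis_swap (h : IsAdaptedFrame o e a b c d) :
    (confocalPod h).axis = (confocalPod h.swap).axis := by
  ext x
  rw [h.mem_axis_iff, h.swap.mem_axis_iff]
  constructor
  · rintro ⟨z, rfl⟩
    exact ⟨√2 - z, by rw [framePoint_swap]; simp⟩
  · rintro ⟨z, rfl⟩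
    exact ⟨√2 - z, by rw [framePoint_swap]⟩

theorem mem_directrix_iff (h : IsAdaptedFrame o e a b c d)
    {x : E3} :
    x ∈ (confocalPod h).directrix ↔ ∃ t, x = framePoint o e t 0 (-((6 + √2) / 4)) := by
  have hz : (0 : ℝ) < (2 + 3 * √2) / 4 := by positivity
  have hd : dist (framePoint o e 0 0 0) (podCenter o e) = (2 + 3 * √2) / 4 :=
    dist_framePoint_eq h.orthonormal _ _ _ _ _ _ _ hz.le (by ring)
  have h4 : framePoint o e 0 0 0 - podCenter o e = (-((2 + 3 * √2) / 4)) • e 2 := by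
    simp only [podCenter, framePoint]; module
  have h5 : (6 + √2) / 4 / ((2 + 3 * √2) / 4) * (-((2 + 3 * √2) / 4)) = -((6 + √2) / 4) := by
    rw [mul_neg, div_mul_cancel₀ _ hz.ne']
  have h6 : b - a = (-2 : ℝ) • e 0 := by
    rw [h.eq_a, h.eq_b]; simp only [framePoint]; module
  rw [ParabolicPod.directrix, AffineSubspace.mem_mk', h.midpoint_beam]
  simp only [confocalPod]
  rw [hd, h4, smul_smul, h5, h6, Submodule.mem_span_singleton]
  constructor
  · rintro ⟨t, ht⟩
    refine ⟨t * -2, ?_⟩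
    rw [vsub_eq_sub, eq_comm, sub_eq_iff_eq_add] at ht
    rw [ht]
    simp only [framePoint]; module
  · rintro ⟨t, rfl⟩
    refine ⟨-t / 2, ?_⟩
    simp only [framePoint, vsub_eq_sub]; module

theorem podCenter_swap_mem_peaString (h : IsAdaptedFrame o e a b c d) :
    (confocalPod h.swap).center ∈ (confocalPod h).peaString := by
  have hs : √2 ≤ 2 := Real.sqrt_le_iff.2 ⟨by norm_num, by norm_num⟩
  have h0 := Real.sqrt_nonneg 2
  change podCenter _ _ ∈ _
  rw [podCenter_swap]
  refine ⟨h.framePoint_mem_plane _ _, ?_⟩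
  have h1 : Metric.infDist (framePoint o e 0 0 (-((2 - √2) / 4)))
      ((confocalPod h).directrix : Set E3) = (2 + √2) / 2 := by
    refine infDist_eq_of_forall_le (h.mem_directrix_iff.2 ⟨0, rfl⟩) ?_ ?_
    · exact dist_framePoint_eq h.orthonormal _ _ _ _ _ _ _ (by positivity) (by ring)
    · intro z hz
      obtain ⟨t, rfl⟩ := h.mem_directrix_iff.1 hz
      rw [le_dist_framePoint_iff h.orthonormal _ _ _ _ _ _ _ (by positivity)]
      nlinarith [sq_nonneg t]
  rw [h1]
  exact dist_framePoint_eq h.orthonormal _ _ _ _ _ _ _ (by positivity) (by ring)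

theorem isBulbCenter_podCenter_swap (h : IsAdaptedFrame o e a b c d) :
    (confocalPod h).IsBulbCenter (confocalPod h.swap).center := by
  have hs : √2 ≤ 2 := Real.sqrt_le_iff.2 ⟨by norm_num, by norm_num⟩
  have h0 := Real.sqrt_nonneg 2
  change (confocalPod h).IsBulbCenter (podCenter _ _)
  rw [podCenter_swap]
  exact ⟨h.framePoint_mem_arc (by linarith) (by linarith) (by ring), h.mem_axis_iff.2 ⟨_, rfl⟩⟩

theorem swap_center_eq (h : IsAdaptedFrame o e a b c d) :
    (confocalPod h).center = framePoint (framePoint o e 0 0 √2) ![e 1, e 0, -e 2] 0 0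
      (-((2 - √2) / 4)) := by
  rw [framePoint_swap]
  change framePoint _ _ _ _ _ = _
  congr 1
  ring

theorem center_mem_peaString_swap (h : IsAdaptedFrame o e a b c d) :
    (confocalPod h).center ∈ (confocalPod h.swap).peaString := by
  have := h.swap.podCenter_swap_mem_peaString
  change podCenter _ _ ∈ _ at this
  rw [podCenter_swap] at this
  rwa [h.swap_center_eq]

theorem isBulbCenter_center_swap (h : IsAdaptedFrame o e a b c d) :
    (confocalPod h.swap).IsBulbCenter (confocalPod h).center := by
  have := h.swap.isBulbCenter_podCenter_swap
  change (confocalPod h.swap).IsBulbCenter (podCenter _ _) at this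
  rw [podCenter_swap] at this
  rwa [h.swap_center_eq]

theorem plane_direction_swap_orthogonal_le (h : IsAdaptedFrame o e a b c d) :
    (confocalPod h.swap).plane.directionᗮ ≤ (confocalPod h).plane.direction := by
  intro v hv
  rw [Submodule.mem_orthogonal] at hv
  have h0 : ⟪e 1, v⟫ = 0 := hv _ (by
    have := AffineSubspace.vsub_mem_direction (h.swap.framePoint_mem_plane 1 0)
      (h.swap.framePoint_mem_plane 0 0)
    rw [framePoint_swap, framePoint_swap] at this
    convert this using 1
    simp only [framePoint, vsub_eq_sub]; module)
  rw [eq_sum_inner_smul_of_orthonormal h.orthonormal v, h0, zero_smul, add_zero]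
  have := AffineSubspace.vsub_mem_direction (h.framePoint_mem_plane ⟪e 0, v⟫ ⟪e 2, v⟫)
      (h.framePoint_mem_plane 0 0)
  convert this using 1
  simp only [framePoint, vsub_eq_sub]; module

theorem convexConfocal_swap (h : IsAdaptedFrame o e a b c d) :
    ConvexConfocal (confocalPod h.swap) (confocalPod h) :=
  ⟨⟨h.axis_eq_axis_swap.symm, h.plane_direction_swap_orthogonal_le,
    h.podCenter_swap_mem_peaString, h.center_mem_peaString_swap⟩,
    h.isBulbCenter_podCenter_swap, h.isBulbCenter_center_swap⟩

/-- The points of the wedge-pod surface along `cd` that are generated by its bulb. -/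
theorem framePoint_mem_wedgePod (h : IsAdaptedFrame o e a b c d)
    {S C : ℝ} (hC : √3 / 2 ≤ C) (hSC : S ^ 2 + C ^ 2 = 1) :
    framePoint o e ((2 - √2) / 4 * S) 0 ((2 + 3 * √2) / 4 + (2 - √2) / 4 * C) ∈
      wedgePod c d a b := by
  have h0 := Real.sqrt_nonneg 2
  have h2 : √2 ^ 2 = 2 := Real.sq_sqrt (by norm_num)
  have hs : √2 ≤ 1.42 := Real.sqrt_le_iff.2 ⟨by norm_num, by norm_num⟩
  have hs' : 1.41 ≤ √2 := Real.le_sqrt_of_sq_le (by norm_num)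
  have ht : 1.73 ≤ √3 := Real.le_sqrt_of_sq_le (by norm_num)
  have hC1 : C ≤ 1 := by nlinarith [sq_nonneg S]
  -- Polar equation of the pea string about its focus; 2 + √2 is the distance from focus to
  -- directrix. The point y is at distance l from the focus, opposite to the direction (S, 0, C).
  obtain ⟨l, hl⟩ : ∃ l, l * (1 + C) = 2 + √2 := 
    ⟨(2 + √2) / (1 + C), div_mul_cancel₀ _ (by linarith)⟩
  have hl0 : 0 < l := by nlinarith
  have hl1 : l ≤ 1.84 := by nlinarith
  refine ⟨_, _, h.convexConfocal_swap, _, h.isBulbCenter_center_swap.1,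
    framePoint o e (-(l * S)) 0 ((2 + 3 * √2) / 4 - l * C), ?_, ?_⟩
  -- The bound √3/2 ≤ C keeps y on the far side of the beam; it is sufficient, not sharp.
  · refine h.framePoint_mem_arc (by nlinarith) (by nlinarith) ?_
    have : (6 + √2) / 4 + ((2 + 3 * √2) / 4 - l * C) = l := by linarith
    rw [this]
    linear_combination l ^ 2 * hSC
  · have h5 : (confocalPod h.swap).peaRadius (confocalPod h).center = (2 - √2) / 4 := by
      rw [h.swap_center_eq, h.swap.peaRadius_framePoint, abs_neg, abs_of_nonneg (by linarith)]
    have h6 : dist (confocalPod h).center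
        (framePoint o e (-(l * S)) 0 ((2 + 3 * √2) / 4 - l * C)) = l :=
      dist_framePoint_eq h.orthonormal _ _ _ _ _ _ _ hl0.le
        (by linear_combination l ^ 2 * hSC)
    have h7 : (confocalPod h).center -
        framePoint o e (-(l * S)) 0 ((2 + 3 * √2) / 4 - l * C) = l • (S • e 0 + C • e 2) := by
      change podCenter o e - _ = _
      simp only [podCenter, framePoint]; module
    rw [outerPoint, h5, h6, h7, smul_smul, div_mul_cancel₀ _ hl0.ne']
    change _ = podCenter o e + _
    simp only [podCenter, framePoint]; module

end IsAdaptedFrame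

/-! ### Scaling from width 1 to width 2 -/

theorem mem_dihedralWedge_half {a b c d x : E3} (h : (2 : ℝ) • x ∈ dihedralWedge a b c d) :
    x ∈ dihedralWedge ((1 / 2 : ℝ) • a) ((1 / 2 : ℝ) • b) ((1 / 2 : ℝ) • c)
      ((1 / 2 : ℝ) • d) := by
  obtain ⟨t, s, s', hs, hs', hx⟩ := h
  refine ⟨t, s, s', hs, hs', ?_⟩
  have : x = (1 / 2 : ℝ) • (2 : ℝ) • x := by rw [smul_smul]; norm_num
  rw [this, hx]
  module

theorem dist_two_smul (x q : E3) :
    dist ((2 : ℝ) • x) q = 2 * dist x ((1 / 2 : ℝ) • q) := by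
  have : q = (2 : ℝ) • (1 / 2 : ℝ) • q := by rw [smul_smul]; norm_num
  conv_lhs => rw [this]
  rw [dist_smul₀]; norm_num

theorem two_smul_mem_closedBall {x q : E3} (h : x ∈ Metric.closedBall ((1 / 2 : ℝ) • q) 1) :
    dist ((2 : ℝ) • x) q ≤ 2 := by
  rw [dist_two_smul]
  linarith [Metric.mem_closedBall.1 h]

theorem two_smul_mem_spindle {a b c x : E3}
    (h : x ∈ spindle ((1 / 2 : ℝ) • a) ((1 / 2 : ℝ) • b) ((1 / 2 : ℝ) • c) 1) :
    (2 : ℝ) • x ∈ spindle a b c 2 := by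
  obtain ⟨y, ⟨⟨t, u, hu, hy⟩, hc⟩, ha, hb⟩ := h
  refine ⟨(2 : ℝ) • y, ⟨⟨t, u, hu, ?_⟩, ?_⟩, ?_, ?_⟩
  · rw [hy]; module
  · rw [dist_two_smul]; linarith
  · rw [dist_two_smul, dist_two_smul, ha]
  · rw [dist_two_smul, dist_two_smul, hb]

/-! ### Support bounds near a sharp and a rounded edge -/

namespace IsAdaptedFrame

variable {o : E3} {e : Fin 3 → E3} {a b c d : E3}

theorem ball_left_iff (h : IsAdaptedFrame o e a b c d)
    {X Y Z : ℝ} :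
    dist (framePoint o e X Y Z) a ≤ 2 ↔ (X - 1) ^ 2 + Y ^ 2 + Z ^ 2 ≤ 4 := by
  rw [h.eq_a, dist_framePoint_le_iff h.orthonormal _ _ _ _ _ _ _ (by norm_num)]
  norm_num

theorem ball_right_iff (h : IsAdaptedFrame o e a b c d)
    {X Y Z : ℝ} :
    dist (framePoint o e X Y Z) b ≤ 2 ↔ (X + 1) ^ 2 + Y ^ 2 + Z ^ 2 ≤ 4 := by
  rw [h.eq_b, dist_framePoint_le_iff h.orthonormal _ _ _ _ _ _ _ (by norm_num)]
  norm_num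

theorem support_le_of_balls (h : IsAdaptedFrame o e a b c d)
    {X Y Z S C : ℝ} (hS : 0 ≤ S) (hSC : √3 * S ≤ C)
    (ha : dist (framePoint o e X Y Z) a ≤ 2) (hb : dist (framePoint o e X Y Z) b ≤ 2) :
    S * X + C * Z ≤ √3 * C := by
  rw [h.ball_left_iff] at ha
  rw [h.ball_right_iff] at hb
  have h3 : √3 ^ 2 = 3 := Real.sq_sqrt (by norm_num)
  have h0 : 0 < √3 := by positivity
  have hC : 0 ≤ C := le_trans (by positivity) hSC
  -- The tangent half spaces of the two balls at (0, 0, √3). The condition on S and C puts (S, 0, C)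
  -- in the cone spanned by their normals (-1, 0, √3) and (1, 0, √3).
  have h1 : -X + √3 * (Z - √3) ≤ 0 := by nlinarith [sq_nonneg X, sq_nonneg Y, sq_nonneg (Z - √3)]
  have h2 : X + √3 * (Z - √3) ≤ 0 := by nlinarith [sq_nonneg X, sq_nonneg Y, sq_nonneg (Z - √3)]
  have h4 : √3 * (S * X + C * (Z - √3)) ≤ 0 := by
    rcases le_total 0 X with hX | hX
    · nlinarith [mul_nonneg hC (neg_nonneg.2 h2), mul_nonneg hX (sub_nonneg.2 hSC)]
    · nlinarith [mul_nonneg hC (neg_nonneg.2 h1), mul_nonneg (neg_nonneg.2 hX) hC,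
        mul_nonneg (mul_nonneg h0.le hS) (neg_nonneg.2 hX)]
  have := nonpos_of_mul_nonpos_right h4 h0
  linarith

/-- Equal distances to `c` and `d` mean equal Y and equal distance √3 u from the line `cd`. The ball
about `a` bounds this distance by 2 - √3, so the projection to the XZ-plane lies in the disk of that
radius about (0, √2). -/
theorem support_le_of_mem_spindle (h : IsAdaptedFrame o e a b c d)
    {X Y Z S C : ℝ} (hSC : S ^ 2 + C ^ 2 = 1)
    (hx : framePoint o e X Y Z ∈ spindle c d a 2) :
    S * X + C * Z ≤ √2 * C + (2 - √3) := by
  have h2 : √2 ^ 2 = 2 := Real.sq_sqrt (by norm_num)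
  have h3 : √3 ^ 2 = 3 := Real.sq_sqrt (by norm_num)
  have h0 : 0 < √3 := by positivity
  obtain ⟨y, ⟨⟨t, u, hu, hy⟩, hya⟩, hc, hd⟩ := hx
  have hy' : y = framePoint o e (-u) (1 - 2 * t + u) (√2 + √2 * u) := by
    rw [hy, h.eq_a, h.eq_c, h.eq_d]; simp only [framePoint]; module
  rw [hy'] at hya hc hd
  rw [h.ball_left_iff] at hya
  have hc2 := congrArg (· ^ 2) hc
  have hd2 := congrArg (· ^ 2) hd
  simp only [h.eq_c, h.eq_d, dist_framePoint_sq h.orthonormal] at hc2 hd2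
  have hY : Y = 1 - 2 * t + u := by linarith
  have hr : X ^ 2 + (Z - √2) ^ 2 = 3 * u ^ 2 := by
    rw [hY] at hc2
    linear_combination hc2 + u ^ 2 * h2
  -- The ball about `a` gives 3(1 + u)² ≤ 4.
  have hu' : √3 * (1 + u) ≤ 2 := by
    refine abs_le_of_sq_le_sq' ?_ (by norm_num) |>.2
    nlinarith [sq_nonneg (1 - 2 * t + u)]
  have hsup : S * X + C * (Z - √2) ≤ √3 * u := by
    refine abs_le_of_sq_le_sq' ?_ (by positivity) |>.2
    have : (S * X + C * (Z - √2)) ^ 2 + (C * X - S * (Z - √2)) ^ 2 = 3 * u ^ 2 := by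
      rw [← hr]; linear_combination (X ^ 2 + (Z - √2) ^ 2) * hSC
    nlinarith [sq_nonneg (C * X - S * (Z - √2))]
  linarith

theorem framePoint_mem_dihedralWedge (h : IsAdaptedFrame o e a b c d)
    {X Y Z : ℝ} (h1 : √2 * X ≤ Z - √2)
    (h2 : -(√2 * X) ≤ Z - √2) : framePoint o e X Y Z ∈ dihedralWedge c d a b := by
  have hs : √2 * √2 = 2 := Real.mul_self_sqrt (by norm_num)
  have h0 : 0 < √2 := by positivity
  have hk1 : √2 / 4 * (Z - √2 - √2 * X) = √2 / 4 * (Z - √2) - X / 2 := by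
    linear_combination (-X / 4) * hs
  have hk2 : √2 / 4 * (Z - √2 + √2 * X) = √2 / 4 * (Z - √2) + X / 2 := by
    linear_combination (X / 4) * hs
  have hZ : Z = √2 + 2 * (√2 / 4 * (Z - √2)) * √2 := by
    linear_combination (-(Z - √2) / 2) * hs
  refine ⟨(1 + 2 * (√2 / 4 * (Z - √2)) - Y) / 2, √2 / 4 * (Z - √2) - X / 2,
    √2 / 4 * (Z - √2) + X / 2, hk1 ▸ mul_nonneg (by positivity) (by linarith),
    hk2 ▸ mul_nonneg (by positivity) (by linarith), ?_⟩
  generalize √2 / 4 * (Z - √2) = k at hZ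
  rw [h.eq_a, h.eq_b, h.eq_c, h.eq_d, hZ]
  simp only [framePoint]; module

/-- A point outside the wedge lies past one of its two face planes. Split (S, 0, C) along and across
that plane: the transverse part contributes at most 0, and the part along it is bounded by the ball
about `a` or `b`, which reaches at most 2 - √3 beyond `cd` in that direction. So the bound of the
rounded part persists outside the wedge. -/
theorem support_le_of_notMem_dihedralWedge (h : IsAdaptedFrame o e a b c d)
    {X Y Z S C : ℝ} (hS : 0 ≤ S) (hSC : √3 * S ≤ C)
    (hSC1 : S ^ 2 + C ^ 2 = 1)
    (ha : dist (framePoint o e X Y Z) a ≤ 2) (hb : dist (framePoint o e X Y Z) b ≤ 2)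
    (hx : framePoint o e X Y Z ∉ dihedralWedge c d a b) :
    S * X + C * Z ≤ √2 * C + (2 - √3) := by
  rw [h.ball_left_iff] at ha
  rw [h.ball_right_iff] at hb
  have h2 : √2 ^ 2 = 2 := Real.sq_sqrt (by norm_num)
  have h3 : √3 ^ 2 = 3 := Real.sq_sqrt (by norm_num)
  have h20 : 0 < √2 := by positivity
  have h30 : 0 < √3 := by positivity
  have h32 : √3 < 2 := by nlinarith
  have h23 : √2 ≤ √3 := Real.sqrt_le_sqrt (by norm_num)
  have hC : 0 ≤ C := le_trans (by positivity) hSC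
  have hβ : √2 * S ≤ C := le_trans (mul_le_mul_of_nonneg_right h23 hS) hSC
  have hα : S + √2 * C ≤ √3 := by
    refine abs_le_of_sq_le_sq' ?_ (by positivity) |>.2
    nlinarith [sq_nonneg (C - √2 * S)]
  have hα' : -S + √2 * C ≤ √3 := by linarith
  have hα0 : 0 ≤ -S + √2 * C := by nlinarith
  by_cases hl : √2 * X ≤ Z - √2
  · have hr : Z - √2 + √2 * X < 0 := by
      by_contra hr
      exact hx (h.framePoint_mem_dihedralWedge hl (by linarith))
    -- Cauchy–Schwarz in the ball about `a`, for the vector (-1, 0, √2) of norm √3.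
    have h5 : -X + 1 + √2 * Z ≤ 2 * √3 := by
      refine abs_le_of_sq_le_sq' ?_ (by positivity) |>.2
      nlinarith [sq_nonneg (√2 * (X - 1) + Z), sq_nonneg Y]
    have h6 : -X + √2 * (Z - √2) ≤ √3 * (2 - √3) := by nlinarith
    have h7 := mul_le_mul_of_nonneg_left h6 hα0
    have h8 : (-S + √2 * C) * (√3 * (2 - √3)) ≤ √3 * (√3 * (2 - √3)) :=
      mul_le_mul_of_nonneg_right hα' (mul_nonneg h30.le (by linarith))
    have h9 : (C + √2 * S) * (Z - √2 + √2 * X) ≤ 0 :=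
      mul_nonpos_of_nonneg_of_nonpos (by positivity) hr.le
    -- Orthogonal decomposition with respect to (-1, √2) and (√2, 1), both of squared norm 3.
    have h10 : 3 * (S * X + C * (Z - √2)) = (-S + √2 * C) * (-X + √2 * (Z - √2)) +
      (C + √2 * S) * (Z - √2 + √2 * X) := by
      linear_combination (-C * (Z - √2) - S * X) * h2
    have h11 : √3 * (√3 * (2 - √3)) = 3 * (2 - √3) := by linear_combination (2 - √3) * h3
    linarith
  · have h5 : X + 1 + √2 * Z ≤ 2 * √3 := by
      refine abs_le_of_sq_le_sq' ?_ (by positivity) |>.2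
      nlinarith [sq_nonneg (√2 * (X + 1) - Z), sq_nonneg Y]
    have h6 : X + √2 * (Z - √2) ≤ √3 * (2 - √3) := by nlinarith
    have h7 := mul_le_mul_of_nonneg_left h6 (show 0 ≤ S + √2 * C by positivity)
    have h8 : (S + √2 * C) * (√3 * (2 - √3)) ≤ √3 * (√3 * (2 - √3)) :=
      mul_le_mul_of_nonneg_right hα (mul_nonneg h30.le (by linarith))
    have h9 : (C - √2 * S) * (Z - √2 - √2 * X) ≤ 0 :=
      mul_nonpos_of_nonneg_of_nonpos (by linarith) (by linarith)
    have h10 : 3 * (S * X + C * (Z - √2)) = (S + √2 * C) * (X + √2 * (Z - √2)) +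
      (C - √2 * S) * (Z - √2 - √2 * X) := by
      linear_combination (-C * (Z - √2) - S * X) * h2
    have h11 : √3 * (√3 * (2 - √3)) = 3 * (2 - √3) := by linear_combination (2 - √3) * h3
    linarith

end IsAdaptedFrame

/-! ### Membership in Robert's body and exclusion from the sum -/

/-- The permutation that exchanges the first and the last pair. -/
def swapPairs : Equiv.Perm (Fin 4) := Equiv.addRight 2

theorem exists_isAdaptedFrame_perm {p : Fin 4 → E3} (hp : IsRegularTetrahedron p 2)
    (σ : Equiv.Perm (Fin 4)) :
    ∃ o e, IsAdaptedFrame o e (p (σ 0)) (p (σ 1)) (p (σ 2)) (p (σ 3)) := by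
  apply exists_isAdaptedFrame <;> exact hp _ _ (by simp)

section bounds

variable {p : Fin 4 → E3} {σ : Equiv.Perm (Fin 4)} {o : E3} {e : Fin 3 → E3}
  {rounded : Fin 4 → Fin 4 → Prop} {x : E3} {X Y Z S C : ℝ}

theorem support_roundedReuleaux_le (h : IsAdaptedFrame o e (p (σ 0)) (p (σ 1)) (p (σ 2)) (p (σ 3)))
    (hx : x ∈ roundedReuleaux (fun i => (1 / 2 : ℝ) • p i) 1 rounded)
    (hX : (2 : ℝ) • x = framePoint o e X Y Z) (hS : 0 ≤ S) (hSC : √3 * S ≤ C) :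
    S * X + C * Z ≤ √3 * C := by
  have hb := fun i => two_smul_mem_closedBall (Set.mem_iInter.1 hx.1 i)
  rw [hX] at hb
  exact h.support_le_of_balls hS hSC (hb _) (hb _)

theorem support_roundedReuleaux_le_of_rounded
    (h : IsAdaptedFrame o e (p (σ 0)) (p (σ 1)) (p (σ 2)) (p (σ 3)))
    (hx : x ∈ roundedReuleaux (fun i => (1 / 2 : ℝ) • p i) 1 rounded)
    (hX : (2 : ℝ) • x = framePoint o e X Y Z) (hS : 0 ≤ S) (hSC : √3 * S ≤ C)
    (hSC1 : S ^ 2 + C ^ 2 = 1) (hr : rounded (σ 2) (σ 3)) :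
    S * X + C * Z ≤ √2 * C + (2 - √3) := by
  have hb := fun i => two_smul_mem_closedBall (Set.mem_iInter.1 hx.1 i)
  by_cases hw : framePoint o e X Y Z ∈ dihedralWedge (p (σ 2)) (p (σ 3)) (p (σ 0)) (p (σ 1))
  · rw [← hX] at hw
    have := two_smul_mem_spindle (hx.2 (swapPairs.trans σ) hr (mem_dihedralWedge_half hw))
    rw [hX] at this
    exact h.support_le_of_mem_spindle hSC1 this
  · rw [hX] at hb
    exact h.support_le_of_notMem_dihedralWedge hS hSC hSC1 (hb _) (hb _) hw

theorem framePoint_mem_robertsBody (h : IsAdaptedFrame o e (p (σ 0)) (p (σ 1)) (p (σ 2)) (p (σ 3)))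
    (hC : √3 / 2 ≤ C) (hSC : S ^ 2 + C ^ 2 = 1) :
    framePoint o e ((2 - √2) / 4 * S) 0 ((2 + 3 * √2) / 4 + (2 - √2) / 4 * C) ∈
      robertsBody p :=
  subset_convexHull _ _ (Or.inr (Set.mem_iUnion.2 ⟨swapPairs.trans σ,
    h.framePoint_mem_wedgePod hC hSC⟩))

theorem framePoint_mem_section (h : IsAdaptedFrame o e (p (σ 0)) (p (σ 1)) (p (σ 2)) (p (σ 3)))
    (X Z : ℝ) : framePoint o e X 0 Z ∈
    affineSpan ℝ {p (σ 0), p (σ 1), midpoint ℝ (p (σ 2)) (p (σ 3))} := by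
  have ha : line[ℝ, p (σ 0), p (σ 1)] ≤
      affineSpan ℝ {p (σ 0), p (σ 1), midpoint ℝ (p (σ 2)) (p (σ 3))} :=
    affineSpan_mono _ (by intro x hx; rcases hx with rfl | rfl <;> simp)
  have h0 := ha (h.mem_beam_iff.2 ⟨0, rfl⟩)
  have hX := ha (h.mem_beam_iff.2 ⟨X, rfl⟩)
  have hm : midpoint ℝ (p (σ 2)) (p (σ 3)) ∈
      affineSpan ℝ {p (σ 0), p (σ 1), midpoint ℝ (p (σ 2)) (p (σ 3))} :=
    subset_affineSpan _ _ (by simp)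
  have := AffineSubspace.smul_vsub_vadd_mem _ (Z / √2) hm h0 hX
  convert this using 1
  have h3 : Z / √2 * √2 = Z := div_mul_cancel₀ _ (by positivity)
  have h4 : framePoint o e 0 0 √2 - framePoint o e 0 0 0 = √2 • e 2 := by
    simp only [framePoint]; module
  rw [h.swap.midpoint_beam, framePoint_swap, sub_zero, vsub_eq_sub, vadd_eq_add, h4, smul_smul, h3]
  simp only [framePoint]; module

/-- A sum of two bodies, in the first of which the edge opposite to the plane of the section is
rounded, misses a point of the section. -/
theorem framePoint_notMem_add_of_rounded
    (h : IsAdaptedFrame o e (p (σ 0)) (p (σ 1)) (p (σ 2)) (p (σ 3)))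
    {rounded' : Fin 4 → Fin 4 → Prop}
    (hr : rounded (σ 2) (σ 3)) :
    framePoint o e ((2 - √2) / 4 * (5 / 13)) 0 ((2 + 3 * √2) / 4 + (2 - √2) / 4 * (12 / 13)) ∉
      roundedReuleaux (fun i => (1 / 2 : ℝ) • p i) 1 rounded +
        roundedReuleaux (fun i => (1 / 2 : ℝ) • p i) 1 rounded' := by
  rintro ⟨x, hx, y, hy, hxy⟩
  obtain ⟨X, Y, Z, hX⟩ := exists_eq_framePoint h.orthonormal o ((2 : ℝ) • x)
  obtain ⟨X', Y', Z', hX'⟩ := exists_eq_framePoint h.orthonormal o ((2 : ℝ) • y)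
  have hs3 : √3 ≤ 2 := Real.sqrt_le_iff.2 ⟨by norm_num, by norm_num⟩
  -- On the axis both sides equal (2 + √2)/2, so a tilt is needed. The triple 5, 12, 13 gives a
  -- rational unit vector inside the admissible cone. The sharp-edge bound for the second summand
  -- holds whether or not its edge is rounded.
  have b1 := support_roundedReuleaux_le_of_rounded h hx hX (S := 5 / 13) (C := 12 / 13)
    (by norm_num) (by linarith) (by norm_num) hr
  have b2 := support_roundedReuleaux_le h hy hX' (S := 5 / 13) (C := 12 / 13)
    (by norm_num) (by linarith)
  have key : framePoint o e ((X + X') / 2) ((Y + Y') / 2) ((Z + Z') / 2) = x + y := by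
    have : x + y = (1 / 2 : ℝ) • ((2 : ℝ) • x + (2 : ℝ) • y) := by module
    rw [this, hX, hX']; simp only [framePoint]; module
  obtain ⟨e1, -, e2⟩ := framePoint_injective h.orthonormal (key.trans hxy)
  have hs2 : √2 ≤ 1.4143 := Real.sqrt_le_iff.2 ⟨by norm_num, by norm_num⟩
  have hs3' : 1.732 ≤ √3 := Real.le_sqrt_of_sq_le (by norm_num)
  linarith

theorem framePoint_notMem_add_of_rounded_rounded
    (h : IsAdaptedFrame o e (p (σ 0)) (p (σ 1)) (p (σ 2)) (p (σ 3)))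
    {rounded' : Fin 4 → Fin 4 → Prop}
    (hr : rounded (σ 2) (σ 3)) (hr' : rounded' (σ 2) (σ 3)) :
    framePoint o e 0 0 ((2 + 3 * √2) / 4 + (2 - √2) / 4) ∉
      roundedReuleaux (fun i => (1 / 2 : ℝ) • p i) 1 rounded +
        roundedReuleaux (fun i => (1 / 2 : ℝ) • p i) 1 rounded' := by
  rintro ⟨x, hx, y, hy, hxy⟩
  obtain ⟨X, Y, Z, hX⟩ := exists_eq_framePoint h.orthonormal o ((2 : ℝ) • x)
  obtain ⟨X', Y', Z', hX'⟩ := exists_eq_framePoint h.orthonormal o ((2 : ℝ) • y)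
  have b1 := support_roundedReuleaux_le_of_rounded h hx hX (S := 0) (C := 1)
    le_rfl (by norm_num) (by norm_num) hr
  have b2 := support_roundedReuleaux_le_of_rounded h hy hX' (S := 0) (C := 1)
    le_rfl (by norm_num) (by norm_num) hr'
  have key : framePoint o e ((X + X') / 2) ((Y + Y') / 2) ((Z + Z') / 2) = x + y := by
    have : x + y = (1 / 2 : ℝ) • ((2 : ℝ) • x + (2 : ℝ) • y) := by module
    rw [this, hX, hX']; simp only [framePoint]; module
  obtain ⟨-, -, e2⟩ := framePoint_injective h.orthonormal (key.trans hxy)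
  have hs2 : √2 ≤ 1.42 := Real.sqrt_le_iff.2 ⟨by norm_num, by norm_num⟩
  have hs3 : 1.73 ≤ √3 := Real.le_sqrt_of_sq_le (by norm_num)
  linarith

end bounds

/-! ### Case distinction on the rounded edges -/

theorem exists_mem_section_robertsBody_notMem_add {p : Fin 4 → E3}
    (hp : IsRegularTetrahedron p 2) (v w : Fin 4) (σ : Equiv.Perm (Fin 4)) :
    ∃ q ∈ affineSpan ℝ {p (σ 0), p (σ 1), midpoint ℝ (p (σ 2)) (p (σ 3))}, q ∈ robertsBody p ∧
      q ∉ meissnerVertex (fun i => (1 / 2 : ℝ) • p i) 1 v +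
        meissnerFace (fun i => (1 / 2 : ℝ) • p i) 1 w := by
  obtain ⟨o, e, h⟩ := exists_isAdaptedFrame_perm hp σ
  have hs3 : √3 ≤ 1.74 := Real.sqrt_le_iff.2 ⟨by norm_num, by norm_num⟩
  have hbody := framePoint_mem_robertsBody h (S := 5 / 13) (C := 12 / 13) (by linarith)
    (by norm_num)
  by_cases hv : σ 2 = v ∨ σ 3 = v
  · exact ⟨_, framePoint_mem_section h _ _, hbody, framePoint_notMem_add_of_rounded h hv⟩
  by_cases hw : σ 2 ≠ w ∧ σ 3 ≠ w
  · refine ⟨_, framePoint_mem_section h _ _, hbody, ?_⟩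
    rw [add_comm]
    exact framePoint_notMem_add_of_rounded h hw
  -- Here the edge opposite to the one in the section is sharp in both summands: v is an end of the
  -- edge in the section and w is not. That edge is thus rounded in both, and the frame is turned
  -- over to use its bulb.
  have hv' : σ 0 = v ∨ σ 1 = v := by
    obtain ⟨i, rfl⟩ := σ.surjective v
    simp only [EmbeddingLike.apply_eq_iff_eq] at hv ⊢
    revert i; decide
  have hw' : σ 0 ≠ w ∧ σ 1 ≠ w := by
    obtain ⟨i, rfl⟩ := σ.surjective w
    simp only [ne_eq, EmbeddingLike.apply_eq_iff_eq] at hw ⊢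
    revert i; decide
  have h' : IsAdaptedFrame (framePoint o e 0 0 √2) ![e 1, e 0, -e 2] (p (swapPairs.trans σ 0))
    (p (swapPairs.trans σ 1)) (p (swapPairs.trans σ 2)) (p (swapPairs.trans σ 3)) := h.swap
  have hbody' := framePoint_mem_robertsBody h' (S := 0) (C := 1) (by linarith) (by norm_num)
  rw [mul_zero, mul_one] at hbody'
  refine ⟨_, ?_, hbody', framePoint_notMem_add_of_rounded_rounded h' hv' hw'⟩
  -- The separating point lies on the common axis, hence also in the original section plane.
  rw [framePoint_swap]
  exact framePoint_mem_section h _ _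

end Peabody

open Peabody in
theorem mainTheorem4 (p : Fin 4 → E3) (hp : IsRegularTetrahedron p 2) (v w : Fin 4) :
    meissnerVertex (fun i => (1 / 2 : ℝ) • p i) 1 v +
        meissnerFace (fun i => (1 / 2 : ℝ) • p i) 1 w ≠ robertsBody p ∧
    ∀ σ : Equiv.Perm (Fin 4),
      (affineSpan ℝ {p (σ 0), p (σ 1), midpoint ℝ (p (σ 2)) (p (σ 3))} : Set E3) ∩
          (meissnerVertex (fun i => (1 / 2 : ℝ) • p i) 1 v +
            meissnerFace (fun i => (1 / 2 : ℝ) • p i) 1 w) ≠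
        (affineSpan ℝ {p (σ 0), p (σ 1), midpoint ℝ (p (σ 2)) (p (σ 3))} : Set E3) ∩
          robertsBody p := by
  constructor
  · intro heq
    obtain ⟨q, -, hq, hq'⟩ := exists_mem_section_robertsBody_notMem_add hp v w 1
    exact hq' (heq ▸ hq)
  · intro σ heq
    obtain ⟨q, hH, hq, hq'⟩ := exists_mem_section_robertsBody_notMem_add hp v w σ
    exact hq' (heq.symm.subset ⟨hH, hq⟩).2
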